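/- Let $M$ be a paracompact smooth manifold of dimension $n$ with a Poisson bracket $\{\cdot,\cdot\}$ on $C^\infty(M)$ (a real Lie bracket such that $\mathrm{ad}(f)=\{f,\cdot\}$ is a derivation of the algebra $C^\infty(M)$ for every $f$), and let $A$ be a Weil algebra, i.e. a finite-dimensional commutative unital real algebra with a unique maximal ideal $\mathfrak m$, of codimension $1$ over $\mathbb{R}$. Let $M^A$ be the smooth manifold of near points of kind $A$ on $M$: its points over $x\in M$ are the algebra homomorphisms $\xi:C^\infty(M)\to A$ with $\xi(f)-f(x)\in\mathfrak m$ for all $f$, and each chart $(U,x_1,\dots,x_n)$ of $M$ gives a chart $U^A\to A^n$, $\xi\mapsto(\xi(x_1),\dots,\xi(x_n))$. For $f\in C^\infty(M)$ let $f^A\in C^\infty(M^A,A)$ be $f^A(\xi)=\xi(f)$, and let $\widetilde{[\mathrm{ad}(f)]^A}$ be the unique $A$-linear derivation of $C^\infty(M^A,A)$ that maps $C^\infty(M^A)$ into itself and sends $g^A$ to $\{f,g\}^A$ for every $g\in C^\infty(M)$. A $1$-form on $C^\infty(M)$ is an $\mathbb{R}$-linear map $\eta:C^\infty(M)\to C^\infty(M)$;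 its differential is $$(d\eta)(f,g)=\{f,\eta(g)\}-\{g,\eta(f)\}-\eta(\{f,g\}).$$ For an $\mathbb{R}$-linear map $\Omega:C^\infty(M)\to C^\infty(M^A,A)$ put $$(\tilde d\,\Omega)(f,g)=\widetilde{[\mathrm{ad}(f)]^A}(\Omega(g))-\widetilde{[\mathrm{ad}(g)]^A}(\Omega(f))-\Omega(\{f,g\}).$$ The prolongation of $\eta$ is $\eta^A:f\mapsto[\eta(f)]^A$. Then for every $1$-form $\eta$ on $C^\infty(M)$ one has $\tilde d\,\eta^A=0$ if and only if $d\eta=0$. In particular $\tilde d\,\eta^A=0$ whenever $\eta(\{f,g\})=\{\eta(f),g\}+\{f,\eta(g)\}$ for all $f,g\in C^\infty(M)$, for instance whenever $\eta$ is a derivation of the Poisson algebra $C^\infty(M)$. -/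

import Mathlib

set_option linter.unusedSectionVars false

open scoped Manifold ContDiff Topology
open IsLocalRing

/-- A Weil algebra: a finite-dimensional commutative unital real algebra with a unique maximal ideal,
which has codimension one. (Below, a Weil algebra carries an algebra norm: every finite-dimensional
algebra has one, and all of them give the same topology and the same smooth maps.) -/
class IsWeilAlgebra (A : Type*) [CommRing A] [Algebra ℝ A] : Prop extends IsLocalRing A where
  finiteDimensional : FiniteDimensional ℝ A
  finrank_quotient : Module.finrank ℝ (A ⧸ maximalIdeal A) = 1

namespace WeilAlgebra
variable {A : Type*} [CommRing A] [Algebra ℝ A] [IsWeilAlgebra A]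

theorem bijective_ofId : Function.Bijective (Algebra.ofId ℝ (A ⧸ maximalIdeal A)) := by
  have h := Subalgebra.bot_eq_top_of_finrank_eq_one (IsWeilAlgebra.finrank_quotient (A := A))
  exact Algebra.bijective_algebraMap_iff.2 h.symm

variable (A) in
/-- The augmentation `A = ℝ ⊕ 𝔪 → ℝ`. -/
noncomputable def augmentation : A →ₐ[ℝ] ℝ :=
  (AlgEquiv.ofBijective (Algebra.ofId ℝ (A ⧸ maximalIdeal A)) bijective_ofId).symm.toAlgHom.comp
    (Ideal.Quotient.mkₐ ℝ (maximalIdeal A))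

theorem augmentation_eq_zero_iff (a : A) : augmentation A a = 0 ↔ a ∈ maximalIdeal A := by
  simp [augmentation, Ideal.Quotient.eq_zero_iff_mem]

theorem sub_mem_iff (a : A) (r : ℝ) :
    a - algebraMap ℝ A r ∈ maximalIdeal A ↔ augmentation A a = r := by
  rw [← augmentation_eq_zero_iff, map_sub, AlgHom.commutes, sub_eq_zero]
  rfl

variable (A) in
theorem exists_pow_eq_bot : ∃ k : ℕ, maximalIdeal A ^ k = ⊥ := by
  have := IsWeilAlgebra.finiteDimensional (A := A)
  have : IsArtinianRing A := IsArtinianRing.of_finite ℝ A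
  exact (isArtinianRing_iff_isNilpotent_maximalIdeal A).mp ‹_›

end WeilAlgebra


namespace WeilAlgebra

theorem contDiff_intervalIntegral {n : ℕ} (m : ℕ) :
    ∀ F : EuclideanSpace ℝ (Fin n) × ℝ → ℝ, ContDiff ℝ ∞ F →
      ContDiff ℝ m (fun x => ∫ t in (0 : ℝ)..1, F (x, t)) := by
  induction m with
  | zero =>
    intro F hF
    exact contDiff_zero.2 (intervalIntegral.continuous_parametric_intervalIntegral_of_continuous'
      (f := fun x t => F (x, t)) hF.continuous 0 1)
  | succ m ih =>
    intro F hF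
    have hF1 : ContDiff ℝ ∞ (fun p : EuclideanSpace ℝ (Fin n) × ℝ =>
        fderiv ℝ (fun x => F (x, p.2)) p.1) := by
      refine ContDiff.fderiv (f := fun (p : EuclideanSpace ℝ (Fin n) × ℝ) x => F (x, p.2))
        (m := ∞) ?_ contDiff_fst (by simp)
      exact hF.comp (contDiff_snd.prodMk (contDiff_snd.comp contDiff_fst))
    have hd : ∀ x₀, HasFDerivAt (fun x => ∫ t in (0 : ℝ)..1, F (x, t))
        (∫ t in (0 : ℝ)..1, fderiv ℝ (fun x => F (x, t)) x₀) x₀ := by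
      intro x₀
      obtain ⟨C, hC⟩ := ((isCompact_closedBall x₀ 1).prod
        (isCompact_Icc (a := (0 : ℝ)) (b := 1))).exists_bound_of_continuousOn
          hF1.continuous.continuousOn
      refine intervalIntegral.hasFDerivAt_integral_of_dominated_of_fderiv_le
        (bound := fun _ => C) (F' := fun x t => fderiv ℝ (fun x => F (x, t)) x)
        (Metric.closedBall_mem_nhds x₀ one_pos) ?_ ?_ ?_ ?_ ?_ ?_
      · exact Filter.Eventually.of_forall fun x =>
          (hF.continuous.comp (by fun_prop : Continuous fun t : ℝ => (x, t))).aestronglyMeasurable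
      · exact (hF.continuous.comp
          (by fun_prop : Continuous fun t : ℝ => (x₀, t))).intervalIntegrable _ _
      · exact (hF1.continuous.comp
          (by fun_prop : Continuous fun t : ℝ => (x₀, t))).aestronglyMeasurable
      · refine Filter.Eventually.of_forall fun t ht x hx => hC (x, t) ⟨hx, ?_⟩
        rw [Set.uIoc_of_le zero_le_one] at ht
        exact ⟨ht.1.le, ht.2⟩
      · exact intervalIntegrable_const
      · refine Filter.Eventually.of_forall fun t _ x _ => ?_
        exact ((hF.comp (contDiff_id.prodMk contDiff_const)).differentiable
          (by simp) x).hasFDerivAt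
    push_cast
    refine contDiff_succ_iff_fderiv_apply.2 ⟨fun x => (hd x).differentiableAt, by simp, ?_⟩
    intro y
    have : (fun x => fderiv ℝ (fun x => ∫ t in (0 : ℝ)..1, F (x, t)) x y) =
        fun x => ∫ t in (0 : ℝ)..1, fderiv ℝ (fun x => F (x, t)) x y := by
      ext x
      rw [(hd x).fderiv, ContinuousLinearMap.intervalIntegral_apply]
      exact (hF1.continuous.comp
          (by fun_prop : Continuous fun t : ℝ => (x, t))).intervalIntegrable _ _
    rw [this]
    exact ih (fun p => fderiv ℝ (fun x => F (x, p.2)) p.1 y) (hF1.clm_apply contDiff_const)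

theorem exists_hadamard {n : ℕ} (g : EuclideanSpace ℝ (Fin n) → ℝ) (hg : ContDiff ℝ ∞ g)
    (x₀ : EuclideanSpace ℝ (Fin n)) :
    ∃ h : Fin n → EuclideanSpace ℝ (Fin n) → ℝ, (∀ i, ContDiff ℝ ∞ (h i)) ∧
      ∀ y, g y = g x₀ + ∑ i, (y i - x₀ i) * h i y := by
  have hc : ContDiff ℝ ∞ (fderiv ℝ g) := hg.fderiv_right (by simp)
  refine ⟨fun i y => ∫ t in (0 : ℝ)..1,
    fderiv ℝ g (x₀ + t • (y - x₀)) (EuclideanSpace.single i 1), fun i => ?_, fun y => ?_⟩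
  · refine contDiff_infty.2 fun m => contDiff_intervalIntegral m
      (fun p => fderiv ℝ g (x₀ + p.2 • (p.1 - x₀)) (EuclideanSpace.single i 1)) ?_
    exact (hc.comp (by fun_prop)).clm_apply contDiff_const
  · have hline : ∀ t : ℝ, HasDerivAt (fun t : ℝ => g (x₀ + t • (y - x₀)))
        (fderiv ℝ g (x₀ + t • (y - x₀)) (y - x₀)) t := by
      intro t
      have h1 : HasDerivAt (fun t : ℝ => x₀ + t • (y - x₀)) (y - x₀) t := by
        simpa using ((hasDerivAt_id t).smul_const (y - x₀)).const_add x₀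
      exact ((hg.differentiable (by simp) _).hasFDerivAt).comp_hasDerivAt t h1
    have hcl : Continuous fun t : ℝ => fderiv ℝ g (x₀ + t • (y - x₀)) :=
      hc.continuous.comp (by fun_prop)
    have hint := intervalIntegral.integral_eq_sub_of_hasDerivAt (a := 0) (b := 1)
      (fun t _ => hline t) ((hcl.clm_apply continuous_const).intervalIntegrable _ _)
    simp only [zero_smul, add_zero, one_smul, add_sub_cancel] at hint
    have hsum : y - x₀ = ∑ i, (y i - x₀ i) • EuclideanSpace.single i (1 : ℝ) := by
      ext j
      simp [Finset.sum_apply, Pi.single_apply]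
    have : ∀ t : ℝ, fderiv ℝ g (x₀ + t • (y - x₀)) (y - x₀) =
        ∑ i, (y i - x₀ i) * fderiv ℝ g (x₀ + t • (y - x₀)) (EuclideanSpace.single i 1) := by
      intro t
      conv_lhs => rw [hsum]
      rw [map_sum]
      simp [← hsum]
    simp only [this] at hint
    rw [intervalIntegral.integral_finsetSum] at hint
    · simp only [intervalIntegral.integral_const_mul] at hint
      linarith
    · intro i _
      exact (continuous_const.mul (hcl.clm_apply continuous_const)).intervalIntegrable _ _

end WeilAlgebra

/-- The set `M^A` of near points of kind `A` on the `n`-dimensional manifold `M`: a point `x`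
together with a homomorphism of algebras `ξ : C^∞(M) → A` such that `ξ(f) - f(x) ∈ 𝔪` for all `f`.
(On a Hausdorff manifold `x` is determined by `ξ`.) -/
structure WeilBundle (n : ℕ) (M : Type*) [TopologicalSpace M]
    [ChartedSpace (EuclideanSpace ℝ (Fin n)) M] (A : Type*) [CommRing A] [Algebra ℝ A]
    [IsWeilAlgebra A] where
  point : M
  hom : C^∞⟮𝓡 n, M; 𝓘(ℝ), ℝ⟯ →ₐ[ℝ] A
  near : ∀ f, hom f - algebraMap ℝ A (f point) ∈ maximalIdeal A

namespace WeilBundle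

section Euclidean
variable {n : ℕ} {A : Type*} [CommRing A] [Algebra ℝ A] [IsWeilAlgebra A]
local notation "E" => EuclideanSpace ℝ (Fin n)

/-- The `i`-th coordinate function of `ℝⁿ`. -/
noncomputable def stdCoord (i : Fin n) : C^∞⟮𝓡 n, E; 𝓘(ℝ), ℝ⟯ :=
  ⟨fun x => x i, (contDiff_piLp_apply 2).contMDiff⟩

theorem aug_hom {M : Type*} [TopologicalSpace M]
    [ChartedSpace (EuclideanSpace ℝ (Fin n)) M] (ξ : WeilBundle n M A)
    (f : C^∞⟮𝓡 n, M; 𝓘(ℝ), ℝ⟯) : WeilAlgebra.augmentation A (ξ.hom f) = f ξ.point :=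
  (WeilAlgebra.sub_mem_iff _ _).1 (ξ.near f)

theorem hom_eq_of_coord_eq (u v : WeilBundle n E A)
    (h : ∀ i, u.hom (stdCoord i) = v.hom (stdCoord i)) : u.hom = v.hom := by
  have hp : u.point = v.point := by
    ext i
    have := congrArg (WeilAlgebra.augmentation A) (h i)
    rw [aug_hom, aug_hom] at this
    exact this
  have key : ∀ k : ℕ, ∀ f, u.hom f - v.hom f ∈ maximalIdeal A ^ k := by
    intro k
    induction k with
    | zero => simp
    | succ k ih =>
      intro f
      obtain ⟨g, hg, hfg⟩ := WeilAlgebra.exists_hadamard f f.contMDiff.contDiff u.point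
      let G : Fin n → C^∞⟮𝓡 n, E; 𝓘(ℝ), ℝ⟯ := fun i => ⟨g i, (hg i).contMDiff⟩
      have hf : f = algebraMap ℝ _ (f u.point) +
          ∑ i, (stdCoord i - algebraMap ℝ _ (u.point i)) * G i := by
        ext y
        have h1 := map_sum (ContMDiffMap.coeFnRingHom (I := 𝓡 n) (I' := 𝓘(ℝ)) (n := ∞) (N := E)
          (R := ℝ)) (fun i => (stdCoord i - algebraMap ℝ _ (u.point i)) * G i) Finset.univ
        have h2 := congrFun h1 y
        rw [Finset.sum_apply] at h2
        refine (hfg y).trans ?_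
        exact congrArg (f u.point + ·) h2.symm
      rw [hf]
      simp only [map_add, map_sum, map_mul, map_sub, AlgHom.commutes, ← h]
      rw [add_sub_add_left_eq_sub, ← Finset.sum_sub_distrib]
      refine Ideal.sum_mem _ fun i _ => ?_
      rw [← mul_sub, pow_succ']
      exact Ideal.mul_mem_mul (u.near (stdCoord i)) (ih _)
  obtain ⟨k, hk⟩ := WeilAlgebra.exists_pow_eq_bot A
  ext f
  have := key k f
  rwa [hk, Ideal.mem_bot, sub_eq_zero] at this

end Euclidean

section Taylor
variable {n : ℕ} {A : Type*} [NormedCommRing A] [NormedAlgebra ℝ A] [IsWeilAlgebra A]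
local notation "E" => EuclideanSpace ℝ (Fin n)

variable (n A) in
/-- `C^∞(ℝⁿ, A)`. -/
noncomputable def smoothFun : Subalgebra ℝ (E → A) where
  carrier := {F | ContDiff ℝ ∞ F}
  mul_mem' {F G} (h1 : ContDiff ℝ ∞ F) (h2 : ContDiff ℝ ∞ G) := ContDiff.mul h1 h2
  add_mem' {F G} (h1 : ContDiff ℝ ∞ F) (h2 : ContDiff ℝ ∞ G) := ContDiff.add h1 h2
  algebraMap_mem' r := (contDiff_const : ContDiff ℝ ∞ fun _ : E => algebraMap ℝ A r)

theorem smoothFun_contDiff (F : smoothFun n A) : ContDiff ℝ ∞ F.1 := F.2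

theorem smoothFun_differentiable (F : smoothFun n A) : Differentiable ℝ F.1 :=
  (smoothFun_contDiff F).differentiable (by simp)

/-- The derivation `∑ i, νᵢ ∂ᵢ` of `C^∞(ℝⁿ, A)`. -/
noncomputable def nilDeriv (ν : Fin n → A) : smoothFun n A →ₗ[ℝ] smoothFun n A where
  toFun F := ⟨fun x => ∑ i, ν i * fderiv ℝ F.1 x (EuclideanSpace.single i 1), by
    refine ContDiff.sum (n := ∞) fun i _ => contDiff_const.mul ?_
    exact ((smoothFun_contDiff F).fderiv_right (by simp)).clm_apply contDiff_const⟩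
  map_add' F G := by
    ext x
    have h := fderiv_add (smoothFun_differentiable F x) (smoothFun_differentiable G x)
    simp [h, mul_add, Finset.sum_add_distrib]
  map_smul' c F := by
    ext x
    have h := fderiv_const_smul (smoothFun_differentiable F x) c
    simp [h, Finset.smul_sum]

theorem nilDeriv_apply (ν : Fin n → A) (F : smoothFun n A) (x : E) :
    (nilDeriv ν F).1 x = ∑ i, ν i * fderiv ℝ F.1 x (EuclideanSpace.single i 1) := rfl

theorem nilDeriv_mul (ν : Fin n → A) (F G : smoothFun n A) :
    nilDeriv ν (F * G) = F * nilDeriv ν G + nilDeriv ν F * G := by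
  ext x
  have h := fderiv_mul (smoothFun_differentiable F x) (smoothFun_differentiable G x)
  change (nilDeriv ν (F * G)).1 x = F.1 x * (nilDeriv ν G).1 x + (nilDeriv ν F).1 x * G.1 x
  have h' : (F * G).1 = F.1 * G.1 := rfl
  simp only [nilDeriv_apply, h', h, Finset.mul_sum, Finset.sum_mul, ← Finset.sum_add_distrib]
  refine Finset.sum_congr rfl fun i _ => ?_
  simp
  ring

theorem fderiv_mem (W : Submodule ℝ A) {F : E → A} (hF : Differentiable ℝ F)
    (h : ∀ x, F x ∈ W) (x v : E) : fderiv ℝ F x v ∈ W := by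
  by_contra hv
  have := IsWeilAlgebra.finiteDimensional (A := A)
  obtain ⟨f, hf, hW⟩ := Submodule.exists_le_ker_of_notMem hv
  apply hf
  have h0 : (LinearMap.toContinuousLinearMap f) ∘ F = fun _ => 0 := by
    ext y
    exact hW (h y)
  have h1 := ((LinearMap.toContinuousLinearMap f).hasFDerivAt.comp x (hF x).hasFDerivAt).fderiv
  rw [h0] at h1
  have := congrArg (fun L => L v) h1
  simpa using this.symm

theorem nilDeriv_mem {ν : Fin n → A} (hν : ∀ i, ν i ∈ maximalIdeal A) {F : smoothFun n A}
    {j : ℕ} (h : ∀ x, F.1 x ∈ maximalIdeal A ^ j) (x : E) :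
    (nilDeriv ν F).1 x ∈ maximalIdeal A ^ (j + 1) := by
  rw [nilDeriv_apply, pow_succ']
  exact Ideal.sum_mem _ fun i _ => Ideal.mul_mem_mul (hν i)
    (fderiv_mem ((maximalIdeal A ^ j).restrictScalars ℝ) (smoothFun_differentiable F) h x _)

theorem nilDeriv_pow_mem {ν : Fin n → A} (hν : ∀ i, ν i ∈ maximalIdeal A) (F : smoothFun n A)
    (j : ℕ) (x : E) : ((nilDeriv ν ^ j) F).1 x ∈ maximalIdeal A ^ j := by
  induction j generalizing x with
  | zero => simp
  | succ j ih =>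
    rw [pow_succ' (nilDeriv ν), Module.End.mul_apply]
    exact nilDeriv_mem hν ih x

variable (A) in
/-- A natural number `k` with `𝔪 ^ k = 0`. -/
noncomputable def nilIndex : ℕ := (WeilAlgebra.exists_pow_eq_bot A).choose

theorem pow_nilIndex {k : ℕ} (hk : nilIndex A ≤ k) : maximalIdeal A ^ k = ⊥ :=
  eq_bot_iff.2 ((Ideal.pow_le_pow_right hk).trans
    (WeilAlgebra.exists_pow_eq_bot A).choose_spec.le)

theorem nilDeriv_pow_eq_zero {ν : Fin n → A} (hν : ∀ i, ν i ∈ maximalIdeal A) {k : ℕ}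
    (hk : nilIndex A ≤ k) : nilDeriv ν ^ k = 0 := by
  ext F x
  have := nilDeriv_pow_mem hν F k x
  rwa [pow_nilIndex hk, Ideal.mem_bot] at this

variable (A) in
/-- A real smooth function seen as an `A`-valued one. -/
noncomputable def lift : C^∞⟮𝓡 n, E; 𝓘(ℝ), ℝ⟯ →ₐ[ℝ] smoothFun n A where
  toFun f := ⟨fun x => algebraMap ℝ A (f x), by
    have : ContDiff ℝ ∞ f := f.contMDiff.contDiff
    exact (algebraMapCLM ℝ A).contDiff.comp this⟩
  map_one' := by ext x; exact map_one _
  map_zero' := by ext x; exact map_zero _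
  map_mul' f g := by ext x; exact map_mul _ _ _
  map_add' f g := by ext x; exact map_add _ _ _
  commutes' r := rfl

theorem lift_apply (f : C^∞⟮𝓡 n, E; 𝓘(ℝ), ℝ⟯) (x : E) : (lift A f).1 x = algebraMap ℝ A (f x) :=
  rfl

/-- The exponential of the derivation `∑ i, νᵢ ∂ᵢ`, which is nilpotent when all `νᵢ ∈ 𝔪`. -/
noncomputable def taylor (ν : Fin n → A) : smoothFun n A →ₗ[ℝ] smoothFun n A :=
  ∑ j ∈ Finset.range (nilIndex A + 2), (j.factorial : ℝ)⁻¹ • nilDeriv ν ^ j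

theorem taylor_apply (ν : Fin n → A) (F : smoothFun n A) (x : E) :
    (taylor ν F).1 x = ∑ j ∈ Finset.range (nilIndex A + 2),
      (j.factorial : ℝ)⁻¹ • ((nilDeriv ν ^ j) F).1 x := by
  have h : taylor ν F = ∑ j ∈ Finset.range (nilIndex A + 2),
      (j.factorial : ℝ)⁻¹ • (nilDeriv ν ^ j) F := by
    simp [taylor, LinearMap.sum_apply]
  rw [h]
  simp [Finset.sum_apply]

theorem taylor_mul {ν : Fin n → A} (hν : ∀ i, ν i ∈ maximalIdeal A) (F G : smoothFun n A) :
    taylor ν (F * G) = taylor ν F * taylor ν G := by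
  let _ : Module ℚ (smoothFun n A) := Module.compHom _ (algebraMap ℚ ℝ)
  have hn : nilDeriv ν ^ (nilIndex A + 2) = 0 := nilDeriv_pow_eq_zero hν (by omega)
  have h := Module.End.exp_mul_of_derivation ℝ (smoothFun n A) (nilDeriv ν) (nilDeriv_mul ν)
    ⟨_, hn⟩ F G
  have e : ∀ F, IsNilpotent.exp (nilDeriv ν) F = taylor ν F := by
    intro F
    rw [IsNilpotent.exp_eq_sum hn, taylor, LinearMap.sum_apply, LinearMap.sum_apply]
    refine Finset.sum_congr rfl fun j _ => ?_
    have : ((j.factorial : ℚ)⁻¹ • (nilDeriv ν ^ j)) F =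
      (algebraMap ℚ ℝ ((j.factorial : ℚ)⁻¹)) • (nilDeriv ν ^ j) F := rfl
    rw [this]
    simp
  rwa [e, e, e] at h

theorem nilDeriv_const (ν : Fin n → A) (F : smoothFun n A) (c : A) (h : F.1 = fun _ => c) :
    nilDeriv ν F = 0 := by
  ext x
  change (nilDeriv ν F).1 x = 0
  rw [nilDeriv_apply, h]
  simp

theorem taylor_const (ν : Fin n → A) (F : smoothFun n A) (c : A) (h : F.1 = fun _ => c) :
    taylor ν F = F := by
  ext x
  rw [taylor_apply, Finset.sum_range_succ', Finset.sum_eq_zero]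
  · simp
  · intro j _
    rw [pow_succ (nilDeriv ν), Module.End.mul_apply, nilDeriv_const ν F c h]
    simp

theorem taylor_stdCoord (ν : Fin n → A) (i : Fin n) (x : E) :
    (taylor ν (lift A (stdCoord i))).1 x = algebraMap ℝ A (x i) + ν i := by
  have h1 : (nilDeriv ν (lift A (stdCoord i))).1 = fun _ => ν i := by
    ext y
    rw [nilDeriv_apply]
    have : (lift A (stdCoord i)).1 =
        ((algebraMapCLM ℝ A).comp (EuclideanSpace.proj i : E →L[ℝ] ℝ) : E → A) := rfl
    simp only [this, ContinuousLinearMap.fderiv]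
    simp
  rw [taylor_apply, Finset.sum_range_succ', Finset.sum_range_succ', Finset.sum_eq_zero]
  · have h2 := congrFun h1 x
    simp only [zero_add, pow_one, Nat.factorial_one, Nat.factorial_zero, Nat.cast_one, inv_one,
      one_smul, pow_zero, Module.End.one_apply, h2, lift_apply]
    exact add_comm _ _
  · intro j _
    rw [pow_succ (nilDeriv ν), pow_succ (nilDeriv ν), Module.End.mul_apply, Module.End.mul_apply,
      nilDeriv_const ν _ _ h1]
    simp

theorem taylor_near {ν : Fin n → A} (hν : ∀ i, ν i ∈ maximalIdeal A) (F : smoothFun n A)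
    (x : E) : (taylor ν F).1 x - F.1 x ∈ maximalIdeal A := by
  rw [taylor_apply, Finset.sum_range_succ']
  simp only [pow_zero, Module.End.one_apply, Nat.factorial_zero, Nat.cast_one, inv_one, one_smul,
    add_sub_cancel_right]
  refine Ideal.sum_mem _ fun j _ => ?_
  refine ((maximalIdeal A).restrictScalars ℝ).smul_mem _ ?_
  exact Ideal.pow_le_self (Nat.succ_ne_zero j) (nilDeriv_pow_mem hν F (j + 1) x)

/-- The point of `ℝⁿ` below a point of `Aⁿ`. -/
noncomputable def realPart (a : Fin n → A) : E :=
  WithLp.toLp 2 fun i => WeilAlgebra.augmentation A (a i)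

/-- The `𝔪`-part of a point of `Aⁿ`. -/
noncomputable def nilPart (a : Fin n → A) (i : Fin n) : A :=
  a i - algebraMap ℝ A (WeilAlgebra.augmentation A (a i))

theorem nilPart_mem (a : Fin n → A) (i : Fin n) : nilPart a i ∈ maximalIdeal A :=
  (WeilAlgebra.sub_mem_iff _ _).2 rfl

/-- The near point of `ℝⁿ` with coordinates `a ∈ Aⁿ`, given by the Taylor expansion
`f ↦ ∑ₖ (1/k!) Dᵏf(x)(ν, …, ν)` at the real part `x` of `a`, where `ν = a - x`. -/
noncomputable def ofCoord (a : Fin n → A) : WeilBundle n E A where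
  point := realPart a
  hom :=
    { toFun := fun f => (taylor (nilPart a) (lift A f)).1 (realPart a)
      map_one' := by
        rw [map_one, taylor_const _ _ 1 rfl]
        rfl
      map_zero' := by
        rw [map_zero, map_zero]
        rfl
      map_mul' := fun f g => by
        rw [map_mul, taylor_mul (nilPart_mem a)]
        rfl
      map_add' := fun f g => by
        rw [map_add, map_add]
        rfl
      commutes' := fun r => by
        rw [AlgHom.commutes, taylor_const _ _ (algebraMap ℝ A r) rfl]
        rfl }
  near f := taylor_near (nilPart_mem a) (lift A f) (realPart a)

theorem ofCoord_hom (a : Fin n → A) (f : C^∞⟮𝓡 n, E; 𝓘(ℝ), ℝ⟯) :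
    (ofCoord a).hom f = (taylor (nilPart a) (lift A f)).1 (realPart a) := rfl

theorem ofCoord_stdCoord (a : Fin n → A) (i : Fin n) : (ofCoord a).hom (stdCoord i) = a i := by
  rw [ofCoord_hom, taylor_stdCoord]
  simp [realPart, nilPart]

theorem contDiff_nilDeriv_pow (F : smoothFun n A) (j : ℕ) :
    ContDiff ℝ ∞ fun p : (Fin n → A) × E => ((nilDeriv p.1 ^ j) F).1 p.2 := by
  induction j with
  | zero => exact (smoothFun_contDiff F).comp contDiff_snd
  | succ j ih =>
    have : (fun p : (Fin n → A) × E => ((nilDeriv p.1 ^ (j + 1)) F).1 p.2) =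
        fun p => ∑ i, p.1 i * fderiv ℝ (fun x => ((nilDeriv p.1 ^ j) F).1 x) p.2
          (EuclideanSpace.single i 1) := by
      ext p
      rw [pow_succ' (nilDeriv p.1), Module.End.mul_apply, nilDeriv_apply]
    rw [this]
    refine ContDiff.sum fun i _ => ContDiff.mul (by fun_prop) ?_
    refine ContDiff.fderiv_apply
      (f := fun (p : (Fin n → A) × E) x => ((nilDeriv p.1 ^ j) F).1 x)
      (m := ∞) ?_ contDiff_snd contDiff_const (by simp)
    exact ih.comp ((contDiff_fst.comp contDiff_fst).prodMk contDiff_snd)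

variable (n A) in
theorem contDiff_realPart : ContDiff ℝ ∞ (realPart : (Fin n → A) → E) := by
  have := IsWeilAlgebra.finiteDimensional (A := A)
  have h : ContDiff ℝ ∞ (WeilAlgebra.augmentation A) :=
    (LinearMap.toContinuousLinearMap (WeilAlgebra.augmentation A).toLinearMap).contDiff
  rw [contDiff_piLp]
  exact fun i => h.comp (contDiff_apply ℝ A i)

variable (n A) in
theorem contDiff_nilPart : ContDiff ℝ ∞ (nilPart : (Fin n → A) → Fin n → A) := by
  have := IsWeilAlgebra.finiteDimensional (A := A)
  have h : ContDiff ℝ ∞ (WeilAlgebra.augmentation A) :=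
    (LinearMap.toContinuousLinearMap (WeilAlgebra.augmentation A).toLinearMap).contDiff
  rw [contDiff_pi]
  exact fun i => (contDiff_apply ℝ A i).sub
    ((algebraMapCLM ℝ A).contDiff.comp (h.comp (contDiff_apply ℝ A i)))

theorem contDiff_ofCoord (f : C^∞⟮𝓡 n, E; 𝓘(ℝ), ℝ⟯) :
    ContDiff ℝ ∞ fun a : Fin n → A => (ofCoord a).hom f := by
  simp only [ofCoord_hom, taylor_apply]
  refine ContDiff.sum fun j _ => ContDiff.const_smul _ ?_
  exact (contDiff_nilDeriv_pow (lift A f) j).comp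
    ((contDiff_nilPart n A).prodMk (contDiff_realPart n A))

theorem hom_eq_ofCoord (u : WeilBundle n E A) (f : C^∞⟮𝓡 n, E; 𝓘(ℝ), ℝ⟯) :
    u.hom f = (ofCoord fun i => u.hom (stdCoord i)).hom f := by
  exact DFunLike.congr_fun (hom_eq_of_coord_eq u (ofCoord fun i => u.hom (stdCoord i))
    fun i => (ofCoord_stdCoord (fun i => u.hom (stdCoord i)) i).symm) f

end Taylor
end WeilBundle

namespace WeilBundle

section Local
variable {n : ℕ} {M : Type*} [TopologicalSpace M] [ChartedSpace (EuclideanSpace ℝ (Fin n)) M]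
  {A : Type*} [CommRing A] [Algebra ℝ A] [IsWeilAlgebra A]

open Classical in
/-- The value of a near point `ξ` on a function `g` that is only smooth near the base point of `ξ`:
it is `ξ(f)` for any global smooth `f` with the same germ as `g` there
(see `evalGerm_eq` for the independence of `f`). -/
noncomputable def evalGerm (ξ : WeilBundle n M A) (g : M → ℝ) : A :=
  if h : ∃ f : C^∞⟮𝓡 n, M; 𝓘(ℝ), ℝ⟯, f =ᶠ[𝓝 ξ.point] g then ξ.hom h.choose else 0

/-- The near point `f ↦ f x`. -/
noncomputable def trivialPoint (x : M) : WeilBundle n M A where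
  point := x
  hom :=
    { toFun := fun f => algebraMap ℝ A (f x)
      map_one' := map_one _
      map_zero' := map_zero _
      map_mul' := fun _ _ => map_mul _ _ _
      map_add' := fun _ _ => map_add _ _ _
      commutes' := fun _ => rfl }
  near f := by
    change algebraMap ℝ A (f x) - algebraMap ℝ A (f x) ∈ _
    simp

variable [IsManifold (𝓡 n) ∞ M] [T2Space M]

theorem exists_global {g : M → ℝ} {U : Set M} (hU : IsOpen U)
    (hg : ContMDiffOn (𝓡 n) 𝓘(ℝ) ∞ g U) {x : M} (hx : x ∈ U) :
    ∃ f : C^∞⟮𝓡 n, M; 𝓘(ℝ), ℝ⟯, f =ᶠ[𝓝 x] g := by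
  obtain ⟨χ, -, hχ⟩ := (SmoothBumpFunction.nhds_basis_tsupport (I := 𝓡 n) x).mem_iff.1
    (hU.mem_nhds hx)
  refine ⟨⟨fun y => χ y • g y, contMDiff_of_tsupport fun y hy => ?_⟩, ?_⟩
  · exact χ.contMDiff.contMDiffAt.smul
      (hg.contMDiffAt (hU.mem_nhds (hχ (tsupport_smul_subset_left _ _ hy))))
  · filter_upwards [χ.eventuallyEq_one] with y hy
    change χ y • g y = g y
    rw [hy]
    simp

theorem hom_congr (ξ : WeilBundle n M A) {f g : C^∞⟮𝓡 n, M; 𝓘(ℝ), ℝ⟯}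
    (h : f =ᶠ[𝓝 ξ.point] g) : ξ.hom f = ξ.hom g := by
  obtain ⟨χ, -, hχ⟩ := (SmoothBumpFunction.nhds_basis_tsupport (I := 𝓡 n) ξ.point).mem_iff.1 h
  let X : C^∞⟮𝓡 n, M; 𝓘(ℝ), ℝ⟯ := ⟨χ, χ.contMDiff⟩
  have h0 : X * (f - g) = 0 := by
    ext y
    change χ y * (f y - g y) = 0
    by_cases hy : y ∈ tsupport χ
    · rw [show f y = g y from hχ hy, sub_self, mul_zero]
    · rw [image_eq_zero_of_notMem_tsupport hy, zero_mul]
  have hu : IsUnit (ξ.hom X) := by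
    rw [← IsLocalRing.notMem_maximalIdeal, ← WeilAlgebra.augmentation_eq_zero_iff, aug_hom]
    change ¬ χ ξ.point = 0
    rw [χ.eq_one]
    exact one_ne_zero
  have h1 := congrArg ξ.hom h0
  rw [map_mul, map_zero, hu.mul_right_eq_zero, map_sub, sub_eq_zero] at h1
  exact h1

theorem evalGerm_eq (ξ : WeilBundle n M A) {f : C^∞⟮𝓡 n, M; 𝓘(ℝ), ℝ⟯} {g : M → ℝ}
    (h : f =ᶠ[𝓝 ξ.point] g) : evalGerm ξ g = ξ.hom f := by
  have h' : ∃ f : C^∞⟮𝓡 n, M; 𝓘(ℝ), ℝ⟯, f =ᶠ[𝓝 ξ.point] g := ⟨f, h⟩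
  rw [evalGerm, dif_pos h']
  exact ξ.hom_congr (h'.choose_spec.trans h.symm)

end Local

section Map
variable {n : ℕ} {M N : Type*} [TopologicalSpace M] [ChartedSpace (EuclideanSpace ℝ (Fin n)) M]
  [IsManifold (𝓡 n) ∞ M] [T2Space M]
  [TopologicalSpace N] [ChartedSpace (EuclideanSpace ℝ (Fin n)) N]
  {A : Type*} [CommRing A] [Algebra ℝ A] [IsWeilAlgebra A]

/-- The image of a near point under a map that is smooth near its base point. -/
noncomputable def map (φ : M → N) {U : Set M} (hU : IsOpen U)
    (hφ : ContMDiffOn (𝓡 n) (𝓡 n) ∞ φ U) (ξ : WeilBundle n M A) (hξ : ξ.point ∈ U) :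
    WeilBundle n N A :=
  have key : ∀ g : C^∞⟮𝓡 n, N; 𝓘(ℝ), ℝ⟯, ∃ f : C^∞⟮𝓡 n, M; 𝓘(ℝ), ℝ⟯,
      f =ᶠ[𝓝 ξ.point] g ∘ φ :=
    fun g => exists_global hU (g.contMDiff.comp_contMDiffOn hφ) hξ
  { point := φ ξ.point
    hom :=
      { toFun := fun g => evalGerm ξ (g ∘ φ)
        map_one' := by
          exact (evalGerm_eq ξ (f := 1) (Filter.Eventually.of_forall fun _ => rfl)).trans (map_one _)
        map_zero' := by
          exact (evalGerm_eq ξ (f := 0) (Filter.Eventually.of_forall fun _ => rfl)).trans (map_zero _)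
        map_mul' := fun g₁ g₂ => by
          obtain ⟨f₁, h₁⟩ := key g₁
          obtain ⟨f₂, h₂⟩ := key g₂
          rw [evalGerm_eq ξ h₁, evalGerm_eq ξ h₂, ← map_mul]
          exact evalGerm_eq ξ (h₁.mul h₂)
        map_add' := fun g₁ g₂ => by
          obtain ⟨f₁, h₁⟩ := key g₁
          obtain ⟨f₂, h₂⟩ := key g₂
          rw [evalGerm_eq ξ h₁, evalGerm_eq ξ h₂, ← map_add]
          exact evalGerm_eq ξ (h₁.add h₂)
        commutes' := fun r => by
          exact (evalGerm_eq ξ (f := algebraMap ℝ _ r)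
            (Filter.Eventually.of_forall fun _ => rfl)).trans (AlgHom.commutes _ _) }
    near := fun g => by
      obtain ⟨f, h⟩ := key g
      change evalGerm ξ (g ∘ φ) - _ ∈ _
      rw [evalGerm_eq ξ h]
      have := h.eq_of_nhds
      simp only [Function.comp_apply] at this
      rw [← this]
      exact ξ.near f }

end Map

@[ext]
theorem ext' {n : ℕ} {M : Type*} [TopologicalSpace M]
    [ChartedSpace (EuclideanSpace ℝ (Fin n)) M] {A : Type*} [CommRing A] [Algebra ℝ A]
    [IsWeilAlgebra A] {ξ ζ : WeilBundle n M A} (hp : ξ.point = ζ.point)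
    (h : ∀ f, ξ.hom f = ζ.hom f) : ξ = ζ := by
  cases ξ
  cases ζ
  simp only [mk.injEq]
  exact ⟨hp, AlgHom.ext h⟩

section Charts
variable {n : ℕ} {M : Type*} [TopologicalSpace M] [ChartedSpace (EuclideanSpace ℝ (Fin n)) M]
  {A : Type*} [NormedCommRing A] [NormedAlgebra ℝ A] [IsWeilAlgebra A]
local notation "E" => EuclideanSpace ℝ (Fin n)

/-- The coordinates `(ξ(x₁), …, ξ(xₙ)) ∈ Aⁿ` of a near point in a chart `e = (x₁, …, xₙ)` of `M`. -/
noncomputable def coord (e : OpenPartialHomeomorph M E) (ξ : WeilBundle n M A) : Fin n → A :=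
  fun i => evalGerm ξ fun p => e p i

variable [IsManifold (𝓡 n) ∞ M] [T2Space M]

theorem realPart_coord {e : OpenPartialHomeomorph M E} (he : e ∈ atlas E M)
    {ξ : WeilBundle n M A} (hξ : ξ.point ∈ e.source) : realPart (coord e ξ) = e ξ.point := by
  have h := contMDiffOn_of_mem_maximalAtlas
    (IsManifold.subset_maximalAtlas (I := 𝓡 n) (n := ∞) he)
  ext i
  exact aug_hom (map e e.open_source h ξ hξ) (stdCoord i)

open Classical in
/-- The near point of `M` with given coordinates in the chart `e`. -/
noncomputable def ofCoordIn (e : OpenPartialHomeomorph M E) (he : e ∈ atlas E M)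
    (a : Fin n → A) : WeilBundle n M A :=
  if h : realPart a ∈ e.target then
    map e.symm e.open_target (contMDiffOn_symm_of_mem_maximalAtlas
      (IsManifold.subset_maximalAtlas (I := 𝓡 n) (n := ∞) he)) (ofCoord a) h
  else trivialPoint (e.symm (realPart a))

theorem ofCoordIn_point {e : OpenPartialHomeomorph M E} (he : e ∈ atlas E M) (a : Fin n → A) :
    (ofCoordIn e he a).point = e.symm (realPart a) := by
  unfold ofCoordIn
  split_ifs <;> rfl

theorem ofCoordIn_hom {e : OpenPartialHomeomorph M E} (he : e ∈ atlas E M) {a : Fin n → A}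
    (h : realPart a ∈ e.target) (f : C^∞⟮𝓡 n, M; 𝓘(ℝ), ℝ⟯) :
    (ofCoordIn e he a).hom f = evalGerm (ofCoord a) (f ∘ e.symm) := by
  rw [ofCoordIn, dif_pos h]
  rfl

theorem exists_global_comp_symm {e : OpenPartialHomeomorph M E} (he : e ∈ atlas E M) {x : E}
    (hx : x ∈ e.target) (f : C^∞⟮𝓡 n, M; 𝓘(ℝ), ℝ⟯) :
    ∃ G : C^∞⟮𝓡 n, E; 𝓘(ℝ), ℝ⟯, G =ᶠ[𝓝 x] f ∘ e.symm :=
  exists_global e.open_target (f.contMDiff.comp_contMDiffOn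
    (contMDiffOn_symm_of_mem_maximalAtlas
      (IsManifold.subset_maximalAtlas (I := 𝓡 n) (n := ∞) he))) hx

theorem exists_global_coord {e : OpenPartialHomeomorph M E} (he : e ∈ atlas E M) {x : M}
    (hx : x ∈ e.source) (i : Fin n) :
    ∃ X : C^∞⟮𝓡 n, M; 𝓘(ℝ), ℝ⟯, X =ᶠ[𝓝 x] fun p => e p i :=
  exists_global e.open_source ((stdCoord i).contMDiff.comp_contMDiffOn
    (contMDiffOn_of_mem_maximalAtlas
      (IsManifold.subset_maximalAtlas (I := 𝓡 n) (n := ∞) he))) hx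

theorem ofCoordIn_coord {e : OpenPartialHomeomorph M E} (he : e ∈ atlas E M)
    {ξ : WeilBundle n M A} (hξ : ξ.point ∈ e.source) : ofCoordIn e he (coord e ξ) = ξ := by
  have hr := realPart_coord he hξ
  have ht : realPart (coord e ξ) ∈ e.target := hr ▸ e.map_source hξ
  refine ext' ?_ fun f => ?_
  · rw [ofCoordIn_point, hr, e.left_inv hξ]
  · obtain ⟨G, hG⟩ := exists_global_comp_symm he ht f
    rw [ofCoordIn_hom he ht, evalGerm_eq (ofCoord (coord e ξ)) hG]
    have h := contMDiffOn_of_mem_maximalAtlas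
      (IsManifold.subset_maximalAtlas (I := 𝓡 n) (n := ∞) he)
    refine (hom_eq_ofCoord (map e e.open_source h ξ hξ) G).symm.trans ?_
    change evalGerm ξ (G ∘ e) = _
    refine evalGerm_eq ξ ?_
    rw [hr] at hG
    filter_upwards [(e.continuousAt hξ).eventually hG, e.open_source.mem_nhds hξ] with p hp hps
    simp only [Function.comp_apply] at hp ⊢
    rw [hp, e.left_inv hps]

theorem coord_ofCoordIn {e : OpenPartialHomeomorph M E} (he : e ∈ atlas E M) {a : Fin n → A}
    (ha : realPart a ∈ e.target) : coord e (ofCoordIn e he a) = a := by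
  ext i
  have hs : (ofCoordIn e he a).point ∈ e.source := by
    rw [ofCoordIn_point]
    exact e.map_target ha
  obtain ⟨X, hX⟩ := exists_global_coord he hs i
  rw [coord, evalGerm_eq _ hX, ofCoordIn_hom he ha, ← ofCoord_stdCoord a i]
  refine evalGerm_eq (ofCoord a) ?_
  rw [ofCoordIn_point] at hX
  filter_upwards [(e.symm.continuousAt ha).eventually hX, e.open_target.mem_nhds ha] with p hp hps
  simp only [Function.comp_apply] at hp ⊢
  rw [hp, e.right_inv hps]
  rfl

/-- The chart `U^A → Aⁿ`, `ξ ↦ (ξ(x₁), …, ξ(xₙ))`, of `M^A` for a chart `(U, x₁, …, xₙ)` of `M`. -/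
noncomputable def chart (e : OpenPartialHomeomorph M E) (he : e ∈ atlas E M) :
    PartialEquiv (WeilBundle n M A) (Fin n → A) where
  toFun := coord e
  invFun := ofCoordIn e he
  source := {ξ | ξ.point ∈ e.source}
  target := {a | realPart a ∈ e.target}
  map_source' ξ hξ := by
    rw [Set.mem_ofPred_eq, realPart_coord he hξ]
    exact e.map_source hξ
  map_target' a ha := by
    rw [Set.mem_ofPred_eq, ofCoordIn_point]
    exact e.map_target ha
  left_inv' ξ hξ := ofCoordIn_coord he hξ
  right_inv' a ha := coord_ofCoordIn he ha

theorem chart_trans_source {e e' : OpenPartialHomeomorph M E} (he : e ∈ atlas E M)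
    (he' : e' ∈ atlas E M) :
    ((chart (A := A) e he).symm.trans (chart e' he')).source =
      realPart ⁻¹' (e.symm.trans e').source := by
  ext a
  rw [PartialEquiv.trans_source]
  change realPart a ∈ e.target ∧ (ofCoordIn e he a).point ∈ e'.source ↔ _
  rw [ofCoordIn_point, Set.mem_preimage, OpenPartialHomeomorph.trans_source]
  rfl

theorem isOpen_chart_trans_source {e e' : OpenPartialHomeomorph M E} (he : e ∈ atlas E M)
    (he' : e' ∈ atlas E M) :
    IsOpen ((chart (A := A) e he).symm.trans (chart e' he')).source := by
  rw [chart_trans_source]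
  exact (e.symm.trans e').open_source.preimage (contDiff_realPart n A).continuous

theorem contDiffOn_chart_trans {e e' : OpenPartialHomeomorph M E} (he : e ∈ atlas E M)
    (he' : e' ∈ atlas E M) :
    ContDiffOn ℝ ∞ ((chart (A := A) e he).symm.trans (chart e' he'))
      ((chart (A := A) e he).symm.trans (chart e' he')).source := by
  intro a ha
  rw [chart_trans_source, Set.mem_preimage, OpenPartialHomeomorph.trans_source] at ha
  obtain ⟨ha : realPart a ∈ e.target, ha' : e.symm (realPart a) ∈ e'.source⟩ := ha
  refine ContDiffAt.contDiffWithinAt (contDiffAt_pi.2 fun i => ?_)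
  obtain ⟨X, hX⟩ := exists_global_coord he' ha' i
  obtain ⟨G, hG⟩ := exists_global_comp_symm he ha X
  refine (contDiff_ofCoord G).contDiffAt.congr_of_eventuallyEq ?_
  have hc : ContinuousAt (realPart : (Fin n → A) → E) a :=
    (contDiff_realPart n A).continuous.continuousAt
  have h1 := hc.eventually (e.open_target.mem_nhds ha)
  have h2 := hc.eventually (eventually_eventually_nhds.2 hG)
  have h3 := hc.eventually ((e.symm.continuousAt ha).eventually (eventually_eventually_nhds.2 hX))
  filter_upwards [h1, h2, h3] with b hb1 hb2 hb3
  change evalGerm (ofCoordIn e he b) (fun p => e' p i) = _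
  rw [← ofCoordIn_point he b] at hb3
  rw [evalGerm_eq (ofCoordIn e he b) hb3, ofCoordIn_hom he hb1]
  exact evalGerm_eq (ofCoord b) hb2

variable (n M A) in
/-- The atlas of `M^A` formed by the charts `U^A → Aⁿ`. -/
noncomputable def core : ChartedSpaceCore (Fin n → A) (WeilBundle n M A) where
  atlas := {c | ∃ (e : OpenPartialHomeomorph M E) (he : e ∈ atlas E M), c = chart e he}
  chartAt ξ := chart (chartAt E ξ.point) (chart_mem_atlas E ξ.point)
  mem_chart_source ξ := mem_chart_source E ξ.point
  chart_mem_atlas ξ := ⟨_, _, rfl⟩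
  open_source := by
    rintro _ _ ⟨e, he, rfl⟩ ⟨e', he', rfl⟩
    exact isOpen_chart_trans_source he he'
  continuousOn_toFun := by
    rintro _ _ ⟨e, he, rfl⟩ ⟨e', he', rfl⟩
    exact (contDiffOn_chart_trans he he').continuousOn

noncomputable instance : TopologicalSpace (WeilBundle n M A) := (core n M A).toTopologicalSpace

noncomputable instance : ChartedSpace (Fin n → A) (WeilBundle n M A) := (core n M A).toChartedSpace

instance : IsManifold 𝓘(ℝ, Fin n → A) ∞ (WeilBundle n M A) := by
  refine isManifold_of_contDiffOn _ _ _ ?_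
  intro c c' hc hc'
  obtain ⟨c, ⟨e, he, rfl⟩, rfl⟩ := Set.mem_iUnion₂.1 hc
  obtain ⟨c', ⟨e', he', rfl⟩, rfl⟩ := Set.mem_iUnion₂.1 hc'
  simpa using! contDiffOn_chart_trans (A := A) he he'

theorem contMDiff_eval (f : C^∞⟮𝓡 n, M; 𝓘(ℝ), ℝ⟯) :
    ContMDiff 𝓘(ℝ, Fin n → A) 𝓘(ℝ, A) ∞ fun ξ : WeilBundle n M A => ξ.hom f := by
  intro ξ
  have he := chart_mem_atlas E ξ.point
  have hr : realPart (coord (chartAt E ξ.point) ξ) = chartAt E ξ.point ξ.point :=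
    realPart_coord he (mem_chart_source E ξ.point)
  obtain ⟨G, hG⟩ := exists_global_comp_symm he (mem_chart_target E ξ.point) f
  have h1 : ContMDiffAt 𝓘(ℝ, Fin n → A) 𝓘(ℝ, Fin n → A) ∞ (coord (chartAt E ξ.point)) ξ :=
    contMDiffAt_extChartAt (I := 𝓘(ℝ, Fin n → A)) (x := ξ)
  refine ((contDiff_ofCoord (A := A) G).contMDiff.contMDiffAt.comp ξ h1).congr_of_eventuallyEq ?_
  have h2 : ContinuousAt (fun ζ : WeilBundle n M A => realPart (coord (chartAt E ξ.point) ζ)) ξ :=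
    (contDiff_realPart n A).continuous.continuousAt.comp h1.continuousAt
  rw [← hr] at hG
  filter_upwards [h2.eventually (eventually_eventually_nhds.2 hG),
    (chartAt (Fin n → A) ξ).open_source.mem_nhds (mem_chart_source _ ξ)] with ζ hζ hs
  have hs : ζ.point ∈ (chartAt E ξ.point).source := hs
  have ht : realPart (coord (chartAt E ξ.point) ζ) ∈ (chartAt E ξ.point).target := by
    rw [realPart_coord he hs]
    exact (chartAt E ξ.point).map_source hs
  have h3 := ofCoordIn_hom he ht f
  rw [ofCoordIn_coord he hs, evalGerm_eq (ofCoord (coord (chartAt E ξ.point) ζ)) hζ] at h3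
  exact h3

end Charts

section Functions
variable (n : ℕ) (M : Type*) [TopologicalSpace M] [ChartedSpace (EuclideanSpace ℝ (Fin n)) M]
  [IsManifold (𝓡 n) ∞ M] [T2Space M]
  (A : Type*) [NormedCommRing A] [NormedAlgebra ℝ A] [IsWeilAlgebra A]

/-- The `A`-algebra `C^∞(M^A, A)`. -/
noncomputable def smoothFunctions : Subalgebra A (WeilBundle n M A → A) where
  carrier := {φ | ContMDiff 𝓘(ℝ, Fin n → A) 𝓘(ℝ, A) ∞ φ}
  mul_mem' {φ ψ} (hφ : ContMDiff 𝓘(ℝ, Fin n → A) 𝓘(ℝ, A) ∞ φ)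
      (hψ : ContMDiff 𝓘(ℝ, Fin n → A) 𝓘(ℝ, A) ∞ ψ) :=
    ContDiff.comp_contMDiff (g := fun p : A × A => p.1 * p.2) contDiff_mul (hφ.prodMk_space hψ)
  add_mem' {φ ψ} (hφ : ContMDiff 𝓘(ℝ, Fin n → A) 𝓘(ℝ, A) ∞ φ)
      (hψ : ContMDiff 𝓘(ℝ, Fin n → A) 𝓘(ℝ, A) ∞ ψ) := ContMDiff.add hφ hψ
  algebraMap_mem' a := (contMDiff_const : ContMDiff 𝓘(ℝ, Fin n → A) 𝓘(ℝ, A) ∞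
    fun _ : WeilBundle n M A => a)

variable {n M}

/-- The homomorphism `C^∞(M) → C^∞(M^A, A)`, `f ↦ f^A`, where `f^A(ξ) = ξ(f)`. -/
noncomputable def prolong : C^∞⟮𝓡 n, M; 𝓘(ℝ), ℝ⟯ →ₐ[ℝ] smoothFunctions n M A where
  toFun f := ⟨fun ξ => ξ.hom f, contMDiff_eval f⟩
  map_one' := by ext ξ; exact map_one ξ.hom
  map_zero' := by ext ξ; exact map_zero ξ.hom
  map_mul' f g := by ext ξ; exact map_mul ξ.hom f g
  map_add' f g := by ext ξ; exact map_add ξ.hom f g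
  commutes' r := by ext ξ; exact ξ.hom.commutes r

/-- The prolongation `θ^A : C^∞(M) → C^∞(M^A, A)`, `f ↦ [θ(f)]^A` of a vector field `θ` on `M`. -/
noncomputable def prolongVectorField
    (θ : Derivation ℝ C^∞⟮𝓡 n, M; 𝓘(ℝ), ℝ⟯ C^∞⟮𝓡 n, M; 𝓘(ℝ), ℝ⟯) :
    C^∞⟮𝓡 n, M; 𝓘(ℝ), ℝ⟯ →ₗ[ℝ] smoothFunctions n M A :=
  (prolong A).toLinearMap ∘ₗ θ.toLinearMap

variable {A}

/-- `φ` lies in `C^∞(M^A) ⊆ C^∞(M^A, A)`. -/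
def IsRealValued (φ : smoothFunctions n M A) : Prop :=
  ∀ ξ, φ.1 ξ ∈ Set.range (algebraMap ℝ A)

/-- `D` is an `A`-linear derivation of `C^∞(M^A, A)` that maps `C^∞(M^A)` into itself and satisfies
`D(f^A) = X(f)` for all `f ∈ C^∞(M)`. -/
structure IsExtension (X : C^∞⟮𝓡 n, M; 𝓘(ℝ), ℝ⟯ →ₗ[ℝ] smoothFunctions n M A)
    (D : Derivation A (smoothFunctions n M A) (smoothFunctions n M A)) : Prop where
  isRealValued : ∀ φ, IsRealValued φ → IsRealValued (D φ)
  apply_prolong : ∀ f, D (prolong A f) = X f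

open Classical in
/-- The derivation `X̃` of `C^∞(M^A, A)` with the properties `IsExtension`, for a vector field `X` on
`M^A` seen as a derivation `C^∞(M) → C^∞(M^A, A)`. (It is `0` if there is no such derivation; for a
vector field `X` there is exactly one.) -/
noncomputable def extension (X : C^∞⟮𝓡 n, M; 𝓘(ℝ), ℝ⟯ →ₗ[ℝ] smoothFunctions n M A) :
    Derivation A (smoothFunctions n M A) (smoothFunctions n M A) :=
  if h : ∃ D, IsExtension X D then h.choose else 0

end Functions
end WeilBundle

/-- A Poisson bracket on a commutative real algebra: a Lie bracket such that `{f, ·}` is a derivation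
for every `f`. A Poisson structure on `M` is a Poisson bracket on `C^∞(M)`. -/
structure PoissonBracket (R : Type*) [CommRing R] [Algebra ℝ R] where
  bracket : R →ₗ[ℝ] R →ₗ[ℝ] R
  bracket_self : ∀ f, bracket f f = 0
  jacobi : ∀ f g h, bracket f (bracket g h) = bracket (bracket f g) h + bracket g (bracket f h)
  leibniz : ∀ f g h, bracket f (g * h) = bracket f g * h + g * bracket f h

namespace PoissonBracket
variable {R : Type*} [CommRing R] [Algebra ℝ R] (P : PoissonBracket R)

/-- `ad(f) = {f, ·}` as a derivation. -/
def ad (f : R) : Derivation ℝ R R :=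
  Derivation.mk' (P.bracket f) fun g h => by
    rw [P.leibniz, smul_eq_mul, smul_eq_mul, add_comm, mul_comm h]

/-- The Chevalley-Eilenberg differential of a `1`-form `Ω : R → V` with respect to an action `ρ` of
the Lie algebra `(R, {,})` on `V`: `(dΩ)(f, g) = ρ(f)(Ω g) - ρ(g)(Ω f) - Ω {f, g}`. -/
def differential {V : Type*} [AddCommGroup V] (ρ : R → V → V) (Ω : R → V) (f g : R) : V :=
  ρ f (Ω g) - ρ g (Ω f) - Ω (P.bracket f g)

/-- The differential `d` of a `1`-form `η : R → R`, for the adjoint representation `f ↦ ad(f)`. -/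
def d (η : R →ₗ[ℝ] R) : R → R → R := P.differential (fun f => P.ad f) η

/-- `η` is a derivation of the Lie algebra `(R, {,})`; for instance any derivation of the Poisson
algebra `R`. -/
def IsDerivation (η : R →ₗ[ℝ] R) : Prop :=
  ∀ f g, η (P.bracket f g) = P.bracket (η f) g + P.bracket f (η g)

end PoissonBracket

namespace WeilBundle
variable {n : ℕ} {M : Type*} [TopologicalSpace M] [ChartedSpace (EuclideanSpace ℝ (Fin n)) M]
  [IsManifold (𝓡 n) ∞ M] [T2Space M]
  {A : Type*} [NormedCommRing A] [NormedAlgebra ℝ A] [IsWeilAlgebra A]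

/-- The `1`-form `η^A : f ↦ [η(f)]^A` for a `1`-form `η` on `C^∞(M)`. -/
noncomputable def prolongForm (A : Type*) [NormedCommRing A] [NormedAlgebra ℝ A] [IsWeilAlgebra A]
    (η : C^∞⟮𝓡 n, M; 𝓘(ℝ), ℝ⟯ →ₗ[ℝ] C^∞⟮𝓡 n, M; 𝓘(ℝ), ℝ⟯) :
    C^∞⟮𝓡 n, M; 𝓘(ℝ), ℝ⟯ →ₗ[ℝ] smoothFunctions n M A :=
  (prolong A).toLinearMap ∘ₗ η

/-- The differential `d̃` of a `1`-form `Ω : C^∞(M) → C^∞(M^A, A)`, for the representation of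
`C^∞(M)` that sends `f` to the derivation of `C^∞(M^A, A)` extending the prolongation of `ad(f)`. -/
noncomputable def dTilde (P : PoissonBracket C^∞⟮𝓡 n, M; 𝓘(ℝ), ℝ⟯)
    (Ω : C^∞⟮𝓡 n, M; 𝓘(ℝ), ℝ⟯ →ₗ[ℝ] smoothFunctions n M A) :
    C^∞⟮𝓡 n, M; 𝓘(ℝ), ℝ⟯ → C^∞⟮𝓡 n, M; 𝓘(ℝ), ℝ⟯ → smoothFunctions n M A :=
  P.differential (fun f => extension (prolongVectorField A (P.ad f))) Ω

end WeilBundle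

/-!
The prolongation `f ↦ f^A` is an injective homomorphism `C^∞(M) → C^∞(M^A, A)`, and it intertwines
the differentials: `(d̃ η^A)(f, g) = ((dη)(f, g))^A` (`WeilBundle.dTilde_prolongForm`). This follows
from the definitions once the derivation extending the prolongation of a vector field `θ` on `M` is
known to exist, since it then sends `g^A` to `(θ g)^A`. Uniqueness of the extension is not needed.

To construct it, let `(x₁, …, xₙ)` be a chart of `M`; the coordinates of `ξ ∈ M^A` are the
`ξ(xᵢ) ∈ A`. The extension differentiates a function on `M^A` in the direction whose components at `ξ`
are `ξ(θ xᵢ)`. Such a derivative is `A`-linear, obeys the Leibniz rule, and preserves real-valued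
functions. What remains is that it sends `f^A` to `(θ f)^A`, and that it does not depend on the chart.

For the first (`WeilBundle.chartDeriv_prolong`), fix `ξ`. Both the derivative of `f^A` at `ξ` and
`ξ(θ f)` are, as functions of `f`, derivations `C^∞(M) → A` over the homomorphism `ξ`, and they agree
on the `xᵢ`. By Hadamard's lemma `f = f(p) + ∑ᵢ (xᵢ - xᵢ(p)) hᵢ` near the base point `p` of `ξ`, so a
derivation `δ` over `ξ` that kills the `xᵢ` has `δ f = ∑ᵢ (ξ(xᵢ) - xᵢ(p)) δ hᵢ` with
`ξ(xᵢ) - xᵢ(p) ∈ 𝔪`. By induction `δ f ∈ 𝔪ᵏ` for every `k`, hence `δ = 0` because `𝔪` is nilpotent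
(`WeilBundle.IsDerivationOver.eq_of_coord_eq`). Independence of the chart is the case where `f` is a
coordinate of a second chart (`WeilBundle.chartDeriv_eq_chartDeriv`).
-/

/-! ### Point derivations over a near point -/

namespace WeilBundle

section PointDerivation
variable {n : ℕ} {M : Type*} [TopologicalSpace M] [ChartedSpace (EuclideanSpace ℝ (Fin n)) M]
  {A : Type*} [CommRing A] [Algebra ℝ A] [IsWeilAlgebra A]
local notation "E" => EuclideanSpace ℝ (Fin n)

/-- `δ : C^∞(M) → A` is a derivation over `ξ`: it satisfies the Leibniz rule for the
`C^∞(M)`-module structure that the homomorphism `ξ` puts on `A`. -/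
def IsDerivationOver (ξ : WeilBundle n M A) (δ : C^∞⟮𝓡 n, M; 𝓘(ℝ), ℝ⟯ →ₗ[ℝ] A) : Prop :=
  ∀ f g, δ (f * g) = ξ.hom f * δ g + δ f * ξ.hom g

variable {ξ : WeilBundle n M A}

theorem IsDerivationOver.sub {δ δ' : C^∞⟮𝓡 n, M; 𝓘(ℝ), ℝ⟯ →ₗ[ℝ] A}
    (h : IsDerivationOver ξ δ) (h' : IsDerivationOver ξ δ') : IsDerivationOver ξ (δ - δ') := by
  intro f g
  simp only [LinearMap.sub_apply, h f g, h' f g]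
  ring

theorem IsDerivationOver.map_algebraMap {δ : C^∞⟮𝓡 n, M; 𝓘(ℝ), ℝ⟯ →ₗ[ℝ] A}
    (h : IsDerivationOver ξ δ) (r : ℝ) : δ (algebraMap ℝ _ r) = 0 := by
  have h1 : δ 1 = 0 := by
    have := h 1 1
    simpa using this
  rw [Algebra.algebraMap_eq_smul_one, map_smul, h1, smul_zero]

theorem isDerivationOver_comp (ξ : WeilBundle n M A)
    (θ : Derivation ℝ C^∞⟮𝓡 n, M; 𝓘(ℝ), ℝ⟯ C^∞⟮𝓡 n, M; 𝓘(ℝ), ℝ⟯) :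
    IsDerivationOver ξ (ξ.hom.toLinearMap ∘ₗ θ.toLinearMap) := by
  intro f g
  change ξ.hom (θ (f * g)) = ξ.hom f * ξ.hom (θ g) + ξ.hom (θ f) * ξ.hom g
  rw [θ.leibniz, smul_eq_mul, smul_eq_mul, map_add, map_mul, map_mul, mul_comm (ξ.hom g)]

variable [IsManifold (𝓡 n) ∞ M] [T2Space M]

/-- A derivation over `ξ` only depends on the germ at the base point of `ξ`. -/
theorem IsDerivationOver.congr {δ : C^∞⟮𝓡 n, M; 𝓘(ℝ), ℝ⟯ →ₗ[ℝ] A} (hδ : IsDerivationOver ξ δ)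
    {f g : C^∞⟮𝓡 n, M; 𝓘(ℝ), ℝ⟯} (h : f =ᶠ[𝓝 ξ.point] g) : δ f = δ g := by
  obtain ⟨χ, -, hχ⟩ := (SmoothBumpFunction.nhds_basis_tsupport (I := 𝓡 n) ξ.point).mem_iff.1 h
  let X : C^∞⟮𝓡 n, M; 𝓘(ℝ), ℝ⟯ := ⟨χ, χ.contMDiff⟩
  have h0 : X * (f - g) = 0 := by
    ext y
    change χ y * (f y - g y) = 0
    by_cases hy : y ∈ tsupport χ
    · rw [show f y = g y from hχ hy, sub_self, mul_zero]
    · rw [image_eq_zero_of_notMem_tsupport hy, zero_mul]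
  have hX : ξ.hom X = 1 := by
    rw [← map_one ξ.hom]
    exact ξ.hom_congr χ.eventuallyEq_one
  have h1 := hδ X (f - g)
  rw [h0, map_zero, hX, map_sub ξ.hom, ξ.hom_congr h, sub_self, mul_zero, one_mul, add_zero,
    map_sub] at h1
  exact sub_eq_zero.1 h1.symm

/-- A derivation over `ξ` is determined by its values on local coordinates: iterating Hadamard's
lemma shows that one which kills the coordinates takes its values in every power of `𝔪`. -/
theorem IsDerivationOver.eq_of_coord_eq {δ δ' : C^∞⟮𝓡 n, M; 𝓘(ℝ), ℝ⟯ →ₗ[ℝ] A}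
    (hδ : IsDerivationOver ξ δ) (hδ' : IsDerivationOver ξ δ')
    {e : OpenPartialHomeomorph M E} (he : e ∈ atlas E M) (hξ : ξ.point ∈ e.source)
    {X : Fin n → C^∞⟮𝓡 n, M; 𝓘(ℝ), ℝ⟯} (hX : ∀ i, X i =ᶠ[𝓝 ξ.point] fun p => e p i)
    (h : ∀ i, δ (X i) = δ' (X i)) : δ = δ' := by
  have hd := hδ.sub hδ'
  have hdX : ∀ i, (δ - δ') (X i) = 0 := fun i => sub_eq_zero.2 (h i)
  set d := δ - δ' with hdd
  have key : ∀ k : ℕ, ∀ f, d f ∈ maximalIdeal A ^ k := by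
    intro k
    induction k with
    | zero => simp
    | succ k ih =>
      intro f
      have hes := contMDiffOn_of_mem_maximalAtlas
        (IsManifold.subset_maximalAtlas (I := 𝓡 n) (n := ∞) he)
      obtain ⟨G, hG⟩ := exists_global_comp_symm he (e.map_source hξ) f
      obtain ⟨g, hg, hfg⟩ := WeilAlgebra.exists_hadamard G G.contMDiff.contDiff (e ξ.point)
      choose H hH using fun i => exists_global e.open_source
        ((hg i).contMDiff.comp_contMDiffOn hes) hξ
      have hf : f =ᶠ[𝓝 ξ.point] (algebraMap ℝ _ (G (e ξ.point)) +
          ∑ i, (X i - algebraMap ℝ _ (e ξ.point i)) * H i : C^∞⟮𝓡 n, M; 𝓘(ℝ), ℝ⟯) := by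
        filter_upwards [(e.continuousAt hξ).eventually hG, e.open_source.mem_nhds hξ,
          Filter.eventually_all.2 hX, Filter.eventually_all.2 hH] with p h1 h2 h3 h4
        have h5 := congrFun (map_sum (ContMDiffMap.coeFnRingHom (I := 𝓡 n) (I' := 𝓘(ℝ)) (n := ∞)
          (N := M) (R := ℝ)) (fun i => (X i - algebraMap ℝ _ (e ξ.point i)) * H i) Finset.univ) p
        rw [Finset.sum_apply] at h5
        simp only [Function.comp_apply, e.left_inv h2] at h1
        rw [← h1, hfg]
        refine Eq.trans ?_ (congrArg (G (e ξ.point) + ·) h5.symm)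
        refine congrArg (G (e ξ.point) + ·) (Finset.sum_congr rfl fun i _ => ?_)
        change _ = (X i p - e ξ.point i) * H i p
        rw [h3, h4]
        rfl
      rw [hd.congr hf, map_add, hd.map_algebraMap, zero_add, map_sum]
      refine Ideal.sum_mem _ fun i _ => ?_
      rw [hd, map_sub d, hdX, hd.map_algebraMap, sub_zero, zero_mul, add_zero, map_sub,
        AlgHom.commutes, pow_succ']
      refine Ideal.mul_mem_mul ?_ (ih _)
      have := ξ.near (X i)
      rwa [(hX i).eq_of_nhds] at this
  obtain ⟨k, hk⟩ := WeilAlgebra.exists_pow_eq_bot A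
  ext f
  have := key k f
  rwa [hk, Ideal.mem_bot, hdd, LinearMap.sub_apply, sub_eq_zero] at this

end PointDerivation
end WeilBundle

/-! ### The prolonged vector field in a chart of `M^A` -/

namespace WeilBundle

section Velocity
variable {n : ℕ} {M : Type*} [TopologicalSpace M] [ChartedSpace (EuclideanSpace ℝ (Fin n)) M]
  [IsManifold (𝓡 n) ∞ M] [T2Space M]
  {A : Type*} [NormedCommRing A] [NormedAlgebra ℝ A] [IsWeilAlgebra A]
local notation "E" => EuclideanSpace ℝ (Fin n)

variable (θ : Derivation ℝ C^∞⟮𝓡 n, M; 𝓘(ℝ), ℝ⟯ C^∞⟮𝓡 n, M; 𝓘(ℝ), ℝ⟯)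

open Classical in
/-- The components `ξ(θ xᵢ)` of the prolongation of `θ` at `ξ` in the chart of `M^A` given by a chart
`e = (x₁, …, xₙ)` of `M`. As `xᵢ` is only defined near the base point of `ξ`, it is replaced by any
global function with the same germ (see `velocity_eq`). -/
noncomputable def velocity (e : OpenPartialHomeomorph M E) (ξ : WeilBundle n M A) : Fin n → A :=
  fun i => if h : ∃ X : C^∞⟮𝓡 n, M; 𝓘(ℝ), ℝ⟯, X =ᶠ[𝓝 ξ.point] fun p => e p i then
    ξ.hom (θ h.choose) else 0

theorem velocity_eq {e : OpenPartialHomeomorph M E} {ξ : WeilBundle n M A} {i : Fin n}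
    {X : C^∞⟮𝓡 n, M; 𝓘(ℝ), ℝ⟯} (h : X =ᶠ[𝓝 ξ.point] fun p => e p i) :
    velocity θ e ξ i = ξ.hom (θ X) := by
  have h' : ∃ X : C^∞⟮𝓡 n, M; 𝓘(ℝ), ℝ⟯, X =ᶠ[𝓝 ξ.point] fun p => e p i := ⟨X, h⟩
  rw [velocity, dif_pos h']
  exact (isDerivationOver_comp ξ θ).congr (h'.choose_spec.trans h.symm)

theorem continuous_realPart : Continuous (realPart : (Fin n → A) → E) :=
  (contDiff_realPart n A).continuous

theorem realPart_coord_mem_target {e : OpenPartialHomeomorph M E} (he : e ∈ atlas E M)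
    {ξ : WeilBundle n M A} (hξ : ξ.point ∈ e.source) : realPart (coord e ξ) ∈ e.target := by
  rw [realPart_coord he hξ]
  exact e.map_source hξ

/-- What holds near the base point of `ξ` holds at the base points of all near points whose
coordinates are close to those of `ξ`. -/
theorem eventually_ofCoordIn_point {e : OpenPartialHomeomorph M E} (he : e ∈ atlas E M)
    {ξ : WeilBundle n M A} (hξ : ξ.point ∈ e.source) {p : M → Prop} (hp : ∀ᶠ y in 𝓝 ξ.point, p y) :
    ∀ᶠ a in 𝓝 (coord e ξ), p (ofCoordIn e he a).point := by
  simp only [ofCoordIn_point]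
  have ht := realPart_coord_mem_target he hξ
  have h1 : e.symm (realPart (coord e ξ)) = ξ.point := by
    rw [realPart_coord he hξ, e.left_inv hξ]
  rw [← h1] at hp
  exact continuous_realPart.continuousAt.eventually ((e.symm.continuousAt ht).eventually hp)

theorem eventually_realPart_mem_target {e : OpenPartialHomeomorph M E} (he : e ∈ atlas E M)
    {ξ : WeilBundle n M A} (hξ : ξ.point ∈ e.source) :
    ∀ᶠ a in 𝓝 (coord e ξ), realPart a ∈ e.target :=
  continuous_realPart.continuousAt.eventually
    (e.open_target.mem_nhds (realPart_coord_mem_target he hξ))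

theorem coord_eq_hom {e : OpenPartialHomeomorph M E}
    {ξ : WeilBundle n M A} {i : Fin n} {X : C^∞⟮𝓡 n, M; 𝓘(ℝ), ℝ⟯}
    (h : X =ᶠ[𝓝 ξ.point] fun p => e p i) : coord e ξ i = ξ.hom X :=
  evalGerm_eq ξ h

/-- A smooth function on `M^A` is smooth in the charts of `M^A`. -/
theorem contDiffAt_comp_ofCoordIn (x : M) {ξ : WeilBundle n M A}
    (hξ : ξ.point ∈ (chartAt E x).source) (φ : smoothFunctions n M A) :
    ContDiffAt ℝ ∞ (fun a => φ.1 (ofCoordIn (chartAt E x) (chart_mem_atlas E x) a))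
      (coord (chartAt E x) ξ) := by
  have h1 := contMDiffOn_extChartAt_symm (I := 𝓘(ℝ, Fin n → A)) (n := ∞)
    (trivialPoint x : WeilBundle n M A)
  have h2 : ContMDiff 𝓘(ℝ, Fin n → A) 𝓘(ℝ, A) ∞ φ.1 := φ.2
  have h3 := (h2.comp_contMDiffOn h1).contDiffOn
  refine h3.contDiffAt ((isOpen_extChartAt_target _).mem_nhds ?_)
  rw [extChartAt_target]
  simp only [modelWithCornersSelf_coe_symm, Set.preimage_id_eq, id_eq,
    modelWithCornersSelf_coe, Set.range_id, Set.inter_univ]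
  exact realPart_coord_mem_target (chart_mem_atlas E x) hξ

/-- The derivative of `φ ∈ C^∞(M^A, A)` at `ξ` along the prolongation of `θ`, computed in the chart of
`M^A` around `x`. -/
noncomputable def chartDeriv (x : M) (φ : smoothFunctions n M A) (ξ : WeilBundle n M A) : A :=
  fderiv ℝ (fun a => φ.1 (ofCoordIn (chartAt E x) (chart_mem_atlas E x) a))
    (coord (chartAt E x) ξ) (velocity θ (chartAt E x) ξ)

/-- The derivative of `f^A` at `ξ` in a fixed direction is, as a function of `f`, a derivation over
`ξ`. -/
theorem exists_isDerivationOver_fderiv (x : M) {ξ : WeilBundle n M A}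
    (hξ : ξ.point ∈ (chartAt E x).source) (v : Fin n → A) :
    ∃ δ : C^∞⟮𝓡 n, M; 𝓘(ℝ), ℝ⟯ →ₗ[ℝ] A, IsDerivationOver ξ δ ∧
      ∀ f, δ f = fderiv ℝ (fun a => (ofCoordIn (chartAt E x) (chart_mem_atlas E x) a).hom f)
        (coord (chartAt E x) ξ) v := by
  have hd : ∀ f : C^∞⟮𝓡 n, M; 𝓘(ℝ), ℝ⟯, DifferentiableAt ℝ
      (fun a => (ofCoordIn (chartAt E x) (chart_mem_atlas E x) a).hom f)
      (coord (chartAt E x) ξ) := fun f =>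
    (contDiffAt_comp_ofCoordIn x hξ (prolong A f)).differentiableAt (by simp)
  refine ⟨
    { toFun := fun f => fderiv ℝ
        (fun a => (ofCoordIn (chartAt E x) (chart_mem_atlas E x) a).hom f)
        (coord (chartAt E x) ξ) v
      map_add' := fun f g => ?_
      map_smul' := fun c f => ?_ }, fun f g => ?_, fun f => rfl⟩
  · simp only [map_add]
    rw [fderiv_fun_add (hd f) (hd g)]
    rfl
  · simp only [map_smul]
    rw [fderiv_fun_const_smul (hd f)]
    rfl
  · change fderiv ℝ _ _ v = _ * fderiv ℝ _ _ v + fderiv ℝ _ _ v * _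
    simp only [map_mul]
    rw [fderiv_fun_mul (hd f) (hd g), ofCoordIn_coord (chart_mem_atlas E x) hξ]
    simp only [add_apply, smul_apply, smul_eq_mul]
    ring

/-- The prolonged vector field maps `f^A` to `(θ f)^A`: both `f ↦ ξ(θ f)` and the derivative of `f^A`
at `ξ` are derivations over `ξ`, and they agree on coordinates. -/
theorem chartDeriv_prolong (x : M) {ξ : WeilBundle n M A}
    (hξ : ξ.point ∈ (chartAt E x).source) (f : C^∞⟮𝓡 n, M; 𝓘(ℝ), ℝ⟯) :
    chartDeriv θ x (prolong A f) ξ = ξ.hom (θ f) := by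
  have he := chart_mem_atlas E x
  obtain ⟨δ, hδ, hδf⟩ := exists_isDerivationOver_fderiv x hξ (velocity θ (chartAt E x) ξ)
  choose X hX using fun i => exists_global_coord he hξ i
  have h := hδ.eq_of_coord_eq (isDerivationOver_comp ξ θ) he hξ hX fun i => by
    rw [hδf]
    have h1 : (fun a => (ofCoordIn (chartAt E x) he a).hom (X i)) =ᶠ[𝓝 (coord (chartAt E x) ξ)]
        (ContinuousLinearMap.proj i : (Fin n → A) →L[ℝ] A) := by
      filter_upwards [eventually_ofCoordIn_point he hξ (eventually_eventually_nhds.2 (hX i)),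
        eventually_realPart_mem_target he hξ] with a ha ha'
      rw [← coord_eq_hom ha, coord_ofCoordIn he ha']
      rfl
    rw [h1.fderiv_eq, ContinuousLinearMap.fderiv]
    exact velocity_eq θ (hX i)
  exact (hδf f).symm.trans (LinearMap.congr_fun h f)

/-- The derivative along the prolongation of `θ` does not depend on the chart: the transition map has
components `Yᵢ^A` for local coordinates `Yᵢ` of `M`, so `chartDeriv_prolong` says how it transforms
the velocity. -/
theorem chartDeriv_eq_chartDeriv (x y : M) {ξ : WeilBundle n M A}
    (hx : ξ.point ∈ (chartAt E x).source) (hy : ξ.point ∈ (chartAt E y).source)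
    (φ : smoothFunctions n M A) : chartDeriv θ x φ ξ = chartDeriv θ y φ ξ := by
  have hex := chart_mem_atlas E x
  have hey := chart_mem_atlas E y
  choose Y hY using fun i => exists_global_coord hey hy i
  -- the change of coordinates, written with the prolongations of global functions
  let T : (Fin n → A) → Fin n → A := fun a i => (ofCoordIn (chartAt E x) hex a).hom (Y i)
  have hT : ∀ᶠ a in 𝓝 (coord (chartAt E x) ξ),
      T a = coord (chartAt E y) (ofCoordIn (chartAt E x) hex a) := by
    filter_upwards [eventually_ofCoordIn_point hex hx
      (eventually_eventually_nhds.2 (Filter.eventually_all.2 hY))] with a ha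
    ext i
    exact (coord_eq_hom (Filter.eventually_all.1 ha i)).symm
  have hTd : ∀ i, DifferentiableAt ℝ (fun a => T a i) (coord (chartAt E x) ξ) := fun i =>
    (contDiffAt_comp_ofCoordIn x hx (prolong A (Y i))).differentiableAt (by simp)
  have hTξ : T (coord (chartAt E x) ξ) = coord (chartAt E y) ξ := by
    rw [hT.self_of_nhds, ofCoordIn_coord hex hx]
  have hTv : fderiv ℝ T (coord (chartAt E x) ξ) (velocity θ (chartAt E x) ξ) =
      velocity θ (chartAt E y) ξ := by
    ext i
    rw [fderiv_pi hTd, ContinuousLinearMap.pi_apply, velocity_eq θ (hY i)]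
    exact chartDeriv_prolong θ x hx (Y i)
  have hφ : (fun a => φ.1 (ofCoordIn (chartAt E x) hex a)) =ᶠ[𝓝 (coord (chartAt E x) ξ)]
      (fun a => φ.1 (ofCoordIn (chartAt E y) hey a)) ∘ T := by
    filter_upwards [hT, eventually_ofCoordIn_point hex hx
      ((chartAt E y).open_source.mem_nhds hy)] with a ha ha'
    rw [Function.comp_apply, ha, ofCoordIn_coord hey ha']
  have hφd : DifferentiableAt ℝ (fun a => φ.1 (ofCoordIn (chartAt E y) hey a))
      (T (coord (chartAt E x) ξ)) := by
    rw [hTξ]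
    exact (contDiffAt_comp_ofCoordIn y hy φ).differentiableAt (by simp)
  unfold chartDeriv
  rw [hφ.fderiv_eq, fderiv_comp _ hφd (differentiableAt_pi.2 hTd),
    ContinuousLinearMap.comp_apply, hTv, hTξ]

theorem contMDiffAt_coord (ξ : WeilBundle n M A) :
    ContMDiffAt 𝓘(ℝ, Fin n → A) 𝓘(ℝ, Fin n → A) ∞ (coord (chartAt E ξ.point)) ξ :=
  contMDiffAt_extChartAt (I := 𝓘(ℝ, Fin n → A)) (x := ξ)

theorem eventually_point_mem (ξ : WeilBundle n M A) :
    ∀ᶠ ζ : WeilBundle n M A in 𝓝 ξ, ζ.point ∈ (chartAt E ξ.point).source :=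
  (chartAt (Fin n → A) ξ).open_source.mem_nhds (mem_chart_source _ ξ)

theorem continuous_point : Continuous (point : WeilBundle n M A → M) := by
  refine continuous_iff_continuousAt.2 fun ξ => ?_
  have he := chart_mem_atlas E ξ.point
  have hs := mem_chart_source E ξ.point
  have h : ∀ᶠ ζ : WeilBundle n M A in 𝓝 ξ,
      (chartAt E ξ.point).symm (realPart (coord (chartAt E ξ.point) ζ)) = ζ.point := by
    filter_upwards [eventually_point_mem ξ] with ζ hζ
    rw [realPart_coord he hζ, (chartAt E ξ.point).left_inv hζ]
  have hr : ContinuousAt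
      (fun ζ : WeilBundle n M A => realPart (coord (chartAt E ξ.point) ζ)) ξ :=
    continuous_realPart.continuousAt.comp (contMDiffAt_coord ξ).continuousAt
  have hsymm := (chartAt E ξ.point).symm.continuousAt (realPart_coord_mem_target he hs)
  exact (ContinuousAt.comp (x := ξ) hsymm hr).congr h

theorem contMDiff_chartDeriv (φ : smoothFunctions n M A) :
    ContMDiff 𝓘(ℝ, Fin n → A) 𝓘(ℝ, A) ∞
      fun ξ : WeilBundle n M A => chartDeriv θ ξ.point φ ξ := by
  intro ξ
  have he := chart_mem_atlas E ξ.point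
  have hs := mem_chart_source E ξ.point
  choose X hX using fun i => exists_global_coord he hs i
  have h1 : ContMDiffAt 𝓘(ℝ, Fin n → A) 𝓘(ℝ, (Fin n → A) →L[ℝ] A) ∞ (fun ζ : WeilBundle n M A =>
      fderiv ℝ (fun a => φ.1 (ofCoordIn (chartAt E ξ.point) he a))
        (coord (chartAt E ξ.point) ζ)) ξ :=
    ((contDiffAt_comp_ofCoordIn ξ.point hs φ).fderiv_right
      (m := ∞) (by simp)).contMDiffAt.comp ξ (contMDiffAt_coord ξ)
  have h2 : ContMDiffAt 𝓘(ℝ, Fin n → A) 𝓘(ℝ, Fin n → A) ∞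
      (fun (ζ : WeilBundle n M A) i => ζ.hom (θ (X i))) ξ :=
    contMDiffAt_pi_space.2 fun i => contMDiff_eval (θ (X i)) ξ
  refine (h1.clm_apply h2).congr_of_eventuallyEq ?_
  filter_upwards [eventually_point_mem ξ, continuous_point.continuousAt.eventually
    (eventually_eventually_nhds.2 (Filter.eventually_all.2 hX))] with ζ hζ hζX
  rw [chartDeriv_eq_chartDeriv θ ζ.point ξ.point (mem_chart_source E ζ.point) hζ φ]
  refine congrArg _ (funext fun i => ?_)
  exact velocity_eq θ (Filter.eventually_all.1 hζX i)

/-- The derivative of a function with values in a subspace of `A` takes its values there, as the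
subspace is an intersection of kernels of continuous functionals. -/
theorem fderiv_apply_mem {F : Type*} [NormedAddCommGroup F] [NormedSpace ℝ F] (W : Submodule ℝ A)
    {φ : F → A} {x : F} (hφ : DifferentiableAt ℝ φ x) (h : ∀ y, φ y ∈ W) (v : F) :
    fderiv ℝ φ x v ∈ W := by
  by_contra hv
  have := IsWeilAlgebra.finiteDimensional (A := A)
  obtain ⟨l, hl, hW⟩ := Submodule.exists_le_ker_of_notMem hv
  have h0 : LinearMap.toContinuousLinearMap l ∘ φ = fun _ => 0 := funext fun y => hW (h y)
  have h1 := ((LinearMap.toContinuousLinearMap l).hasFDerivAt.comp x hφ.hasFDerivAt).fderiv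
  rw [h0] at h1
  exact hl (by simpa using (congrArg (fun L => L v) h1).symm)

theorem chartDeriv_isRealValued {φ : smoothFunctions n M A} (hφ : IsRealValued φ)
    (ξ : WeilBundle n M A) : chartDeriv θ ξ.point φ ξ ∈ Set.range (algebraMap ℝ A) := by
  have hd := (contDiffAt_comp_ofCoordIn ξ.point (mem_chart_source E ξ.point) φ).differentiableAt
    (by simp)
  exact fderiv_apply_mem (LinearMap.range (Algebra.linearMap ℝ A)) hd (fun _ => hφ _) _

/-- The `A`-linear derivation of `C^∞(M^A, A)` given by the prolongation of the vector field `θ`. -/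
noncomputable def prolongDerivation :
    Derivation A (smoothFunctions n M A) (smoothFunctions n M A) :=
  have hd (φ : smoothFunctions n M A) (ξ : WeilBundle n M A) :=
    (contDiffAt_comp_ofCoordIn ξ.point (mem_chart_source E ξ.point) φ).differentiableAt (by simp)
  Derivation.mk'
    { toFun := fun φ => ⟨fun ξ => chartDeriv θ ξ.point φ ξ, contMDiff_chartDeriv θ φ⟩
      map_add' := fun φ ψ => by
        ext ξ
        exact DFunLike.congr_fun (fderiv_fun_add (hd φ ξ) (hd ψ ξ)) (velocity θ _ ξ)
      map_smul' := fun a φ => by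
        ext ξ
        exact DFunLike.congr_fun (fderiv_const_mul (hd φ ξ) a) (velocity θ _ ξ) }
    fun φ ψ => by
      ext ξ
      refine (DFunLike.congr_fun (fderiv_fun_mul (hd φ ξ) (hd ψ ξ)) (velocity θ _ ξ)).trans ?_
      rw [ofCoordIn_coord (chart_mem_atlas E ξ.point) (mem_chart_source E ξ.point)]
      rfl

/-- Every vector field `θ` on `M` has a prolongation in the sense of `IsExtension`, so that
`extension` does not take its default value. -/
theorem isExtension_prolongDerivation :
    IsExtension (prolongVectorField A θ) (prolongDerivation (A := A) θ) where
  isRealValued _ hφ ξ := chartDeriv_isRealValued θ hφ ξ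
  apply_prolong f := by
    ext ξ
    exact chartDeriv_prolong θ ξ.point (mem_chart_source E ξ.point) f

theorem extension_prolong (f : C^∞⟮𝓡 n, M; 𝓘(ℝ), ℝ⟯) :
    extension (prolongVectorField A θ) (prolong A f) = prolong A (θ f) := by
  have h : ∃ D, IsExtension (prolongVectorField A θ) D := ⟨_, isExtension_prolongDerivation θ⟩
  rw [extension, dif_pos h]
  exact h.choose_spec.apply_prolong f

end Velocity

/-! ### The differentials of a form and of its prolongation -/

section Differential
variable {n : ℕ} {M : Type*} [TopologicalSpace M] [ChartedSpace (EuclideanSpace ℝ (Fin n)) M]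
  [IsManifold (𝓡 n) ∞ M] [T2Space M]
  (A : Type*) [NormedCommRing A] [NormedAlgebra ℝ A] [IsWeilAlgebra A]

/-- `f` is recovered from `f^A` on the near points `g ↦ g(x)`. -/
theorem prolong_injective :
    Function.Injective (prolong A : C^∞⟮𝓡 n, M; 𝓘(ℝ), ℝ⟯ →ₐ[ℝ] smoothFunctions n M A) := by
  intro f g h
  ext x
  have h1 := congrFun (congrArg Subtype.val h) (trivialPoint x)
  exact (algebraMap ℝ A).injective h1

/-- Prolongation commutes with the differentials: `d̃ η^A = (dη)^A`. -/
theorem dTilde_prolongForm (P : PoissonBracket C^∞⟮𝓡 n, M; 𝓘(ℝ), ℝ⟯)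
    (η : C^∞⟮𝓡 n, M; 𝓘(ℝ), ℝ⟯ →ₗ[ℝ] C^∞⟮𝓡 n, M; 𝓘(ℝ), ℝ⟯) (f g : C^∞⟮𝓡 n, M; 𝓘(ℝ), ℝ⟯) :
    dTilde P (prolongForm A η) f g = prolong A (P.d η f g) := by
  change extension (prolongVectorField A (P.ad f)) (prolong A (η g)) -
    extension (prolongVectorField A (P.ad g)) (prolong A (η f)) -
    prolong A (η (P.bracket f g)) = prolong A (P.ad f (η g) - P.ad g (η f) - η (P.bracket f g))
  rw [extension_prolong, extension_prolong, map_sub, map_sub]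

end Differential
end WeilBundle

namespace PoissonBracket
variable {R : Type*} [CommRing R] [Algebra ℝ R] (P : PoissonBracket R)

theorem bracket_antisymm (f g : R) : P.bracket f g = -P.bracket g f := by
  have h := P.bracket_self (f + g)
  simp only [map_add, LinearMap.add_apply, P.bracket_self, zero_add, add_zero] at h
  exact eq_neg_of_add_eq_zero_right h

theorem d_eq_zero_of_isDerivation {η : R →ₗ[ℝ] R} (h : P.IsDerivation η) : P.d η = 0 := by
  ext f g
  change P.bracket f (η g) - P.bracket g (η f) - η (P.bracket f g) = 0
  rw [h f g, P.bracket_antisymm (η f) g]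
  ring

end PoissonBracket

theorem mainTheorem3 (n : ℕ) (M : Type*) [TopologicalSpace M]
    [ChartedSpace (EuclideanSpace ℝ (Fin n)) M] [IsManifold (𝓡 n) ∞ M]
    [T2Space M] [ParacompactSpace M]
    (A : Type*) [NormedCommRing A] [NormedAlgebra ℝ A] [IsWeilAlgebra A]
    (P : PoissonBracket C^∞⟮𝓡 n, M; 𝓘(ℝ), ℝ⟯)
    (η : C^∞⟮𝓡 n, M; 𝓘(ℝ), ℝ⟯ →ₗ[ℝ] C^∞⟮𝓡 n, M; 𝓘(ℝ), ℝ⟯) :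
    (WeilBundle.dTilde P (WeilBundle.prolongForm A η) = 0 ↔ P.d η = 0) ∧
      (P.IsDerivation η → WeilBundle.dTilde P (WeilBundle.prolongForm A η) = 0) := by
  have h : WeilBundle.dTilde P (WeilBundle.prolongForm A η) = 0 ↔ P.d η = 0 := by
    simp only [funext_iff, WeilBundle.dTilde_prolongForm, Pi.zero_apply]
    exact forall₂_congr fun f g => map_eq_zero_iff _ (WeilBundle.prolong_injective A)
  exact ⟨h, fun hη => h.2 (P.d_eq_zero_of_isDerivation hη)⟩
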